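/- Let $L>0$, $c>0$ and $\beta,\omega\in\mathbb R$ with $1-\beta c>0$, put $\sigma=-\omega-\frac{c^2}{4}$ and suppose $\sigma>\frac{2\pi^2}{L^2}$. Let $0<\eta_2<\eta_1$ and $\kappa\in(0,1)$ be given by $$\eta_1^2+\eta_2^2=2\sigma,\qquad \kappa^2=\frac{\eta_1^2-\eta_2^2}{\eta_1^2},\qquad \frac{2\sqrt2}{\eta_1}K(\kappa)=L,$$ where $K(\kappa)=\int_0^1\frac{dt}{\sqrt{(1-t^2)(1-\kappa^2t^2)}}$, and let $\varphi$ be the $L$-periodic dnoidal wave $$\varphi(\xi)=\sqrt{\frac{c}{1-\beta c}}\;\eta_1\,\mathrm{dn}\Big(\frac{\eta_1}{\sqrt2}\,\xi;\kappa\Big),$$ with $\mathrm{dn}$ the Jacobi elliptic function of modulus $\kappa$. Consider the operators $$L_1=-\partial_x^2+\sigma+3\Big(\beta-\frac1c\Big)\varphi^2,\qquad L_2=-\partial_x^2+\sigma+\Big(\beta-\frac1c\Big)\varphi^2$$ and, for $i=1,2$, the periodic eigenvalue problem $L_if=\lambda f$, $f(0)=f(L)$, $f'(0)=f'(L)$,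 whose eigenvalues are listed in increasing order and repeated according to multiplicity. Then the first three eigenvalues of $L_1$ are simple, and the second one is $0$, with eigenfunction $\varphi'$; in particular $L_1$ has exactly one negative eigenvalue. The first eigenvalue of $L_2$ is $0$, and it is simple. -/

import Mathlib

namespace Dnoidal

/-! ### Jacobi's function `dn` -/

/-- The complete elliptic integral of the first kind, `K(κ)`. -/
noncomputable def ellipticK (κ : ℝ) : ℝ :=
  ∫ t in (0 : ℝ)..1, 1 / Real.sqrt ((1 - t ^ 2) * (1 - κ ^ 2 * t ^ 2))

/-- The incomplete elliptic integral of the first kind,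
`F(θ, κ) = ∫₀^θ ds / √(1 - κ² sin² s)`. -/
noncomputable def ellipticF (κ θ : ℝ) : ℝ :=
  ∫ s in (0 : ℝ)..θ, 1 / Real.sqrt (1 - κ ^ 2 * Real.sin s ^ 2)

/-- Jacobi's amplitude `am(u; κ)`: the inverse function of `θ ↦ F(θ, κ)`, which is a bijection
of `ℝ` for `0 ≤ κ < 1` (see `ellipticF_bijective`). -/
noncomputable def jacobiAm (κ u : ℝ) : ℝ := Function.invFun (ellipticF κ) u

/-- Jacobi's delta amplitude `dn(u; κ) = √(1 - κ² sin² (am(u; κ)))`. -/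
noncomputable def jacobiDn (κ u : ℝ) : ℝ :=
  Real.sqrt (1 - κ ^ 2 * Real.sin (jacobiAm κ u) ^ 2)

theorem ellipticF_radicand_pos {κ : ℝ} (h0 : 0 ≤ κ) (h1 : κ < 1) (s : ℝ) :
    0 < 1 - κ ^ 2 * Real.sin s ^ 2 := by
  have h2 : κ ^ 2 < 1 := by nlinarith
  nlinarith [Real.sin_sq_le_one s, sq_nonneg (Real.sin s), sq_nonneg κ]

theorem ellipticF_continuous_integrand {κ : ℝ} (h0 : 0 ≤ κ) (h1 : κ < 1) :
    Continuous fun s : ℝ => 1 / Real.sqrt (1 - κ ^ 2 * Real.sin s ^ 2) := by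
  refine continuous_const.div (by fun_prop) fun s => ?_
  exact (Real.sqrt_pos.2 (ellipticF_radicand_pos h0 h1 s)).ne'

theorem ellipticF_expand {κ : ℝ} (h0 : 0 ≤ κ) (h1 : κ < 1) {a b : ℝ} (hab : a ≤ b) :
    b - a ≤ ellipticF κ b - ellipticF κ a := by
  have hc := ellipticF_continuous_integrand h0 h1
  unfold ellipticF
  rw [intervalIntegral.integral_interval_sub_left (hc.intervalIntegrable _ _)
    (hc.intervalIntegrable _ _)]
  have hone : ∫ _ in a..b, (1 : ℝ) = b - a := by simp
  rw [← hone]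
  refine intervalIntegral.integral_mono_on hab (by simp) (hc.intervalIntegrable _ _) ?_
  intro s _
  rw [le_div_iff₀ (Real.sqrt_pos.2 (ellipticF_radicand_pos h0 h1 s)), one_mul]
  refine Real.sqrt_le_one.2 ?_
  have : 0 ≤ κ ^ 2 * Real.sin s ^ 2 := by positivity
  linarith

theorem ellipticF_bijective {κ : ℝ} (h0 : 0 ≤ κ) (h1 : κ < 1) :
    Function.Bijective (ellipticF κ) := by
  have hz : ellipticF κ 0 = 0 := by simp [ellipticF]
  have hcont : Continuous (ellipticF κ) :=
    intervalIntegral.continuous_primitive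
      (fun a b => (ellipticF_continuous_integrand h0 h1).intervalIntegrable a b) 0
  have hmono : StrictMono (ellipticF κ) := by
    intro a b hab
    have := ellipticF_expand h0 h1 hab.le
    linarith
  refine ⟨hmono.injective, hcont.surjective ?_ ?_⟩
  · refine Filter.tendsto_atTop_mono' _ ?_ Filter.tendsto_id
    filter_upwards [Filter.eventually_ge_atTop (0 : ℝ)] with x hx
    have := ellipticF_expand h0 h1 hx
    simp only [id]
    linarith
  · refine Filter.tendsto_atBot_mono' _ ?_ Filter.tendsto_id
    filter_upwards [Filter.eventually_le_atBot (0 : ℝ)] with x hx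
    have := ellipticF_expand h0 h1 hx
    simp only [id]
    linarith

theorem ellipticF_jacobiAm {κ : ℝ} (h0 : 0 ≤ κ) (h1 : κ < 1) (u : ℝ) :
    ellipticF κ (jacobiAm κ u) = u :=
  Function.rightInverse_invFun (ellipticF_bijective h0 h1).surjective u

/-- The dnoidal profile `φ(ξ) = √(c / (1 - β c)) η₁ dn(η₁ ξ / √2; κ)`. -/
noncomputable def dnoidalWave (β c η₁ κ : ℝ) (ξ : ℝ) : ℝ :=
  Real.sqrt (c / (1 - β * c)) * η₁ * jacobiDn κ (η₁ / Real.sqrt 2 * ξ)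

/-! ### The periodic eigenvalue problem for `-∂ₓ² + Q` -/

/-- The differential operator `-∂ₓ² + Q`. -/
noncomputable def schrodingerOp (Q f : ℝ → ℝ) (x : ℝ) : ℝ :=
  -deriv (deriv f) x + Q x * f x

/-- The eigenspace of the periodic eigenvalue problem
`-f'' + Q f = μ f`, `f(0) = f(L)`, `f'(0) = f'(L)`: the `C²` solutions `f`.
(For continuous `Q` a solution on `[0, L]` extends uniquely to a solution on `ℝ`, so it makes no
difference that the equation is imposed on the whole line.) -/
noncomputable def periodicEigenspace (Q : ℝ → ℝ) (L μ : ℝ) : Submodule ℝ (ℝ → ℝ) where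
  carrier := {f | ContDiff ℝ 2 f ∧ (∀ x, schrodingerOp Q f x = μ * f x) ∧
    f 0 = f L ∧ deriv f 0 = deriv f L}
  zero_mem' := by
    refine ⟨contDiff_const, fun x => ?_, rfl, ?_⟩
    · simp [schrodingerOp]
    · simp
  add_mem' := by
    rintro f g ⟨hf, hf1, hf2, hf3⟩ ⟨hg, hg1, hg2, hg3⟩
    have df : Differentiable ℝ f := hf.differentiable (by norm_num)
    have dg : Differentiable ℝ g := hg.differentiable (by norm_num)
    have ddf : Differentiable ℝ (deriv f) :=
      (hf.iterate_deriv' 1 1).differentiable (by norm_num)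
    have ddg : Differentiable ℝ (deriv g) :=
      (hg.iterate_deriv' 1 1).differentiable (by norm_num)
    have h1 : deriv (f + g) = deriv f + deriv g := by
      funext x
      exact deriv_add (df x) (dg x)
    have h2 : deriv (deriv f + deriv g) = deriv (deriv f) + deriv (deriv g) := by
      funext x
      exact deriv_add (ddf x) (ddg x)
    refine ⟨hf.add hg, fun x => ?_, ?_, ?_⟩
    · have e1 := hf1 x
      have e2 := hg1 x
      simp only [schrodingerOp, h1, h2, Pi.add_apply] at *
      linarith
    · simp [hf2, hg2]
    · simp [h1, hf3, hg3]
  smul_mem' := by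
    rintro a f ⟨hf, hf1, hf2, hf3⟩
    have df : Differentiable ℝ f := hf.differentiable (by norm_num)
    have ddf : Differentiable ℝ (deriv f) :=
      (hf.iterate_deriv' 1 1).differentiable (by norm_num)
    have h1 : deriv (a • f) = a • deriv f := by
      funext x
      exact deriv_const_smul a (df x)
    have h2 : deriv (a • deriv f) = a • deriv (deriv f) := by
      funext x
      exact deriv_const_smul a (ddf x)
    refine ⟨contDiff_const.smul hf, fun x => ?_, ?_, ?_⟩
    · have e1 := hf1 x
      simp only [schrodingerOp, h1, h2, Pi.smul_apply, smul_eq_mul] at *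
      linear_combination a * e1
    · simp [hf2]
    · simp [h1, hf3]

/-- `μ` is an eigenvalue of the periodic problem. -/
def IsPeriodicEigenvalue (Q : ℝ → ℝ) (L μ : ℝ) : Prop := periodicEigenspace Q L μ ≠ ⊥

/-- The multiplicity of `μ` (`0` if `μ` is not an eigenvalue). -/
noncomputable def eigenMultiplicity (Q : ℝ → ℝ) (L μ : ℝ) : ℕ :=
  Module.finrank ℝ (periodicEigenspace Q L μ)

/-- `μ` is the eigenvalue `λₙ` in the list `λ₀ ≤ λ₁ ≤ λ₂ ≤ …` of all eigenvalues of the periodic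
problem, in increasing order and repeated according to multiplicity: there are finitely many
eigenvalues below `μ`, at most `n` with multiplicity, and those up to and including `μ` are more
than `n` with multiplicity. -/
def IsNthEigenvalue (Q : ℝ → ℝ) (L : ℝ) (n : ℕ) (μ : ℝ) : Prop :=
  IsPeriodicEigenvalue Q L μ ∧
  {ν | ν < μ ∧ IsPeriodicEigenvalue Q L ν}.Finite ∧
  (∑ᶠ ν ∈ {ν | ν < μ ∧ IsPeriodicEigenvalue Q L ν}, eigenMultiplicity Q L ν) ≤ n ∧
  n < (∑ᶠ ν ∈ {ν | ν < μ ∧ IsPeriodicEigenvalue Q L ν}, eigenMultiplicity Q L ν) +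
    eigenMultiplicity Q L μ

/-- The potential of `L₁ = -∂ₓ² - (c²/4 + ω) + 3 (β - 1/c) φ²`. -/
noncomputable def potential₁ (β c ω : ℝ) (φ : ℝ → ℝ) (x : ℝ) : ℝ :=
  -(c ^ 2 / 4 + ω) + 3 * (β - 1 / c) * φ x ^ 2

/-- The potential of `L₂ = -∂ₓ² - (c²/4 + ω) + (β - 1/c) φ²`. -/
noncomputable def potential₂ (β c ω : ℝ) (φ : ℝ → ℝ) (x : ℝ) : ℝ :=
  -(c ^ 2 / 4 + ω) + (β - 1 / c) * φ x ^ 2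

end Dnoidal

namespace Dnoidal

/-! ### Second order linear equations -/

/-! Put `y = η₁ dn(η₁ x / √2; κ)`. The amplitude of the wave makes `(β - 1/c) φ² = -y²`, so the
operators are `-∂² + σ - 3y²` and `-∂² + σ - y²`, where `y'' = σ y - y³` and `2 y'² = (η₁² - y²)(y²
- η₂²)`. Explicit eigenfunctions follow: `y` for the second operator at `0`; for the first, `y'` at
`0` and `y² - r` at `3 (r - σ)` for each root `r` of `3r² - 4σr + η₁²η₂²`. The roots satisfy `r₀ < σ
< r₂`, which gives eigenvalues `λ₀ < 0 < λ₂`.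

It remains to exclude others up to `λ₂`. The potentials are even and periodic, so the even and odd
parts of an eigenfunction solve the Neumann and Dirichlet problems on the half period `[0, H]`
(`even_odd_parts`). The positive ground states there are `y² - r₀` and `-y'`. A solution for any
other eigenvalue has an interior zero, by Rolle applied to its Wronskian with the ground state.
Since `y² - r₂` changes sign only once in `[0, H]`, it has no zero strictly between one end and that
point, and Sturm comparison from that end kills the solution (`eq_zero_of_ne_ground`). For the
second operator `y` has no zero at all and serves as the comparison function. -/

/-- `f` solves `f'' = q f`, with derivative `g`. -/
def SolvesODE (q f g : ℝ → ℝ) : Prop :=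
  ∀ x, HasDerivAt f (g x) x ∧ HasDerivAt g (q x * f x) x

namespace SolvesODE

variable {q f g u v : ℝ → ℝ}

theorem continuous (h : SolvesODE q f g) : Continuous f :=
  continuous_iff_continuousAt.2 fun x => (h x).1.continuousAt

theorem neg (h : SolvesODE q f g) : SolvesODE q (fun x => -f x) (fun x => -g x) := fun x =>
  ⟨(h x).1.neg, (h x).2.neg.congr_deriv (by ring)⟩

theorem add (h : SolvesODE q f g) (h' : SolvesODE q u v) :
    SolvesODE q (fun x => f x + u x) (fun x => g x + v x) := fun x =>
  ⟨(h x).1.add (h' x).1, ((h x).2.add (h' x).2).congr_deriv (by ring)⟩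

theorem const_mul (a : ℝ) (h : SolvesODE q f g) :
    SolvesODE q (fun x => a * f x) (fun x => a * g x) := fun x =>
  ⟨(h x).1.const_mul a, ((h x).2.const_mul a).congr_deriv (by ring)⟩

theorem comp_const_sub (a : ℝ) (h : SolvesODE q f g) :
    SolvesODE (fun x => q (a - x)) (fun x => f (a - x)) (fun x => -g (a - x)) := fun x => by
  have hd : HasDerivAt (fun x : ℝ => a - x) (-1) x := by
    simpa using (hasDerivAt_id x).const_sub a
  exact ⟨((h (a - x)).1.comp x hd).congr_deriv (by ring),
    ((h (a - x)).2.comp x hd).neg.congr_deriv (by ring)⟩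

theorem comp_add_const (a : ℝ) (h : SolvesODE q f g) :
    SolvesODE (fun x => q (x + a)) (fun x => f (x + a)) (fun x => g (x + a)) := fun x =>
  ⟨(h (x + a)).1.comp_add_const x a, (h (x + a)).2.comp_add_const x a⟩

/-- Uniqueness for the initial value problem. -/
theorem eq_zero_of_initial {M : ℝ} (hM : ∀ x, |q x| ≤ M) (h : SolvesODE q f g) {x₀ : ℝ}
    (h0 : f x₀ = 0) (h1 : g x₀ = 0) : ∀ x, f x = 0 := by
  have hM0 : 0 ≤ M := (abs_nonneg _).trans (hM 0)
  -- In the sup norm on pairs, the constant 1 serves the first component of the first-order system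
  -- and `M` the second.
  have hv : ∀ t, LipschitzOnWith (max 1 M).toNNReal
      (fun p : ℝ × ℝ => (p.2, q t * p.1)) Set.univ := by
    intro t
    refine LipschitzOnWith.of_dist_le_mul fun a _ b _ => ?_
    have hcoe : (((max 1 M).toNNReal : NNReal) : ℝ) = max 1 M :=
      Real.coe_toNNReal _ (le_max_of_le_left zero_le_one)
    rw [hcoe, Prod.dist_eq, Prod.dist_eq]
    simp only [Real.dist_eq]
    refine max_le ?_ ?_
    · calc |a.2 - b.2| ≤ max |a.1 - b.1| |a.2 - b.2| := le_max_right _ _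
        _ = 1 * max |a.1 - b.1| |a.2 - b.2| := (one_mul _).symm
        _ ≤ _ := mul_le_mul_of_nonneg_right (le_max_left _ _)
          (le_max_of_le_left (abs_nonneg _))
    · rw [← mul_sub, abs_mul]
      exact mul_le_mul ((hM t).trans (le_max_right _ _)) (le_max_left _ _) (abs_nonneg _)
        (hM0.trans (le_max_right _ _))
  have key := ODE_solution_unique_univ (v := fun t (p : ℝ × ℝ) => (p.2, q t * p.1))
    (s := fun _ => Set.univ) (t₀ := x₀) (f := fun t => (f t, g t)) (g := fun _ => (0, 0)) hv
    (fun t => ⟨(h t).1.prodMk (h t).2, trivial⟩)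
    (fun t => ⟨(hasDerivAt_const t ((0 : ℝ), (0 : ℝ))).congr_deriv (by simp; rfl), trivial⟩)
    (by simp [h0, h1])
  intro x
  exact congrArg Prod.fst (congrFun key x)

theorem eq_of_initial {M : ℝ} (hM : ∀ x, |q x| ≤ M) (h : SolvesODE q f g)
    (h' : SolvesODE q u v) {x₀ : ℝ} (h0 : f x₀ = u x₀) (h1 : g x₀ = v x₀) : ∀ x, f x = u x := by
  intro x
  have := (h.add h'.neg).eq_zero_of_initial hM (x₀ := x₀) (by simp [h0]) (by simp [h1]) x
  linarith

end SolvesODE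

/-! ### Wronskians and Sturm comparison -/

variable {Q f f' ψ ψ' g g' : ℝ → ℝ} {ν μ l M z H : ℝ}

/-- Lagrange's identity: the contributions of `Q` cancel. -/
theorem hasDerivAt_wronskian (hf : SolvesODE (fun x => Q x - ν) f f')
    (hψ : SolvesODE (fun x => Q x - μ) ψ ψ') (x : ℝ) :
    HasDerivAt (fun x => f' x * ψ x - f x * ψ' x) ((μ - ν) * (f x * ψ x)) x :=
  (((hf x).2.mul (hψ x).1).sub ((hf x).1.mul (hψ x).2)).congr_deriv (by ring)

/-- Rolle's theorem for the Wronskian gives an interior point where `(l - ν) f g = 0`, and only `f`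
can vanish there. This replaces orthogonality to the ground state and needs no integral. -/
theorem exists_zero_of_wronskian_boundary (hH : 0 < H)
    (hf : SolvesODE (fun x => Q x - ν) f f') (hg : SolvesODE (fun x => Q x - l) g g')
    (hne : ν ≠ l) (hpos : ∀ x, 0 < x → x < H → 0 < g x)
    (hb0 : f' 0 * g 0 - f 0 * g' 0 = 0) (hbH : f' H * g H - f H * g' H = 0) :
    ∃ p, 0 < p ∧ p < H ∧ f p = 0 := by
  have hW := hasDerivAt_wronskian hf hg
  obtain ⟨p, hp, hp0⟩ := exists_hasDerivAt_eq_zero (f := fun x => f' x * g x - f x * g' x) hH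
    (fun x _ => (hW x).continuousAt.continuousWithinAt) (hb0.trans hbH.symm) (fun x _ => hW x)
  refine ⟨p, hp.1, hp.2, ?_⟩
  have h1 : l - ν ≠ 0 := sub_ne_zero.2 hne.symm
  have h2 := (hpos p hp.1 hp.2).ne'
  simpa [h1, h2] using hp0

theorem deriv_nonneg_of_zero_left {u : ℝ → ℝ} {u' a b : ℝ} (hu : HasDerivAt u u' a) (h0 : u a = 0)
    (hab : a < b) (hpos : ∀ x, a < x → x < b → 0 < u x) : 0 ≤ u' := by
  have h := (hasDerivWithinAt_iff_tendsto_slope' (s := Set.Ioi a) (by simp)).1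
    hu.hasDerivWithinAt
  refine ge_of_tendsto h ?_
  filter_upwards [Ioo_mem_nhdsGT hab] with x hx
  rw [slope_def_field, h0, sub_zero]
  exact div_nonneg (hpos x hx.1 hx.2).le (sub_pos.2 hx.1).le

theorem deriv_nonpos_of_zero_right {u : ℝ → ℝ} {u' a b : ℝ} (hu : HasDerivAt u u' b) (h0 : u b = 0)
    (hab : a < b) (hpos : ∀ x, a < x → x < b → 0 < u x) : u' ≤ 0 := by
  have hd : HasDerivAt (fun x : ℝ => u (-x)) (-u') (-b) := by
    have h1 : HasDerivAt u u' (- -b) := by simpa using hu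
    exact (h1.comp (-b) (hasDerivAt_neg (-b))).congr_deriv (by ring)
  have := deriv_nonneg_of_zero_left (b := -a) hd (by simpa using h0) (by linarith)
    (fun x h1 h2 => hpos _ (by linarith) (by linarith))
  linarith

/-- The Wronskian `f' ψ - f ψ'` is at most `0` at `p` and nondecreasing on `[0, p]`. Under a
Dirichlet condition it starts positive, so `ν = μ` is still excluded; under a Neumann condition it
starts at `0`, and strict growth, hence `ν < μ`, is needed. -/
theorem sturm_comparison_pos {p : ℝ} (hp : 0 < p) (hf : SolvesODE (fun x => Q x - ν) f f')
    (hψ : SolvesODE (fun x => Q x - μ) ψ ψ') (hψ0 : ψ' 0 = 0)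
    (hψpos : ∀ x, 0 ≤ x → x < p → 0 < ψ x) (hfp : f p = 0)
    (hfpos : ∀ x, 0 < x → x < p → 0 < f x) (hinit : f 0 ≠ 0 ∨ f' 0 ≠ 0)
    (hbc : (f 0 = 0 ∧ ν ≤ μ) ∨ (f' 0 = 0 ∧ ν < μ)) : False := by
  have hW := hasDerivAt_wronskian hf hψ
  have hcont : ContinuousOn (fun x => f' x * ψ x - f x * ψ' x) (Set.Icc 0 p) :=
    fun x _ => (hW x).continuousAt.continuousWithinAt
  -- `p` may itself be a zero of `ψ`, so only the limit from the left is available.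
  have hψp : 0 ≤ ψ p := by
    refine ge_of_tendsto (hψ.continuous.continuousWithinAt (s := Set.Iio p)) ?_
    filter_upwards [Ioo_mem_nhdsLT hp] with x hx using (hψpos x hx.1.le hx.2).le
  have hf'p : f' p ≤ 0 := deriv_nonpos_of_zero_right (hf p).1 hfp hp hfpos
  have hWp : f' p * ψ p - f p * ψ' p ≤ 0 := by
    rw [hfp]; nlinarith
  rcases hbc with ⟨h0, hle⟩ | ⟨h0, hlt⟩
  · have hf'0 : 0 ≤ f' 0 := deriv_nonneg_of_zero_left (hf 0).1 h0 hp hfpos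
    have hf'0' : 0 < f' 0 := lt_of_le_of_ne hf'0 (by
      rcases hinit with h | h
      · exact absurd h0 h
      · exact h.symm)
    have hm : MonotoneOn (fun x => f' x * ψ x - f x * ψ' x) (Set.Icc 0 p) := by
      refine monotoneOn_of_deriv_nonneg (convex_Icc 0 p) hcont
        (fun x _ => (hW x).differentiableAt.differentiableWithinAt) fun x hx => ?_
      rw [interior_Icc] at hx
      rw [(hW x).deriv]
      exact mul_nonneg (sub_nonneg.2 hle)
        (mul_pos (hfpos x hx.1 hx.2) (hψpos x hx.1.le hx.2)).le
    have h1 := hm (Set.left_mem_Icc.2 hp.le) (Set.right_mem_Icc.2 hp.le) hp.le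
    simp only [h0] at h1
    have := mul_pos hf'0' (hψpos 0 le_rfl hp)
    linarith
  · have hm : StrictMonoOn (fun x => f' x * ψ x - f x * ψ' x) (Set.Icc 0 p) := by
      refine strictMonoOn_of_deriv_pos (convex_Icc 0 p) hcont fun x hx => ?_
      rw [interior_Icc] at hx
      rw [(hW x).deriv]
      exact mul_pos (sub_pos.2 hlt) (mul_pos (hfpos x hx.1 hx.2) (hψpos x hx.1.le hx.2))
    have h1 := hm (Set.left_mem_Icc.2 hp.le) (Set.right_mem_Icc.2 hp.le) hp
    simp only [h0, hψ0] at h1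
    linarith

/-- Nonzero initial data keep zeros from accumulating at `0` from the right; the zeros in `[ε, p]`
then form a nonempty compact set. -/
theorem exists_first_zero {u : ℝ → ℝ} {u' p : ℝ} (hu : Continuous u) (hd : HasDerivAt u u' 0)
    (hinit : u 0 ≠ 0 ∨ u' ≠ 0) (hp : 0 < p) (hup : u p = 0) :
    ∃ r, 0 < r ∧ r ≤ p ∧ u r = 0 ∧ ∀ x, 0 < x → x < r → u x ≠ 0 := by
  have hev : ∀ᶠ x in nhdsWithin (0 : ℝ) (Set.Ioi 0), u x ≠ 0 := by
    by_cases h0 : u 0 = 0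
    · have h1 : u' ≠ 0 := hinit.resolve_left (fun h => h h0)
      exact nhdsWithin_mono _ (fun x (hx : 0 < x) => hx.ne') (hd.eventually_ne (c := 0) h1)
    · exact nhdsWithin_le_nhds (hu.continuousAt.eventually_ne h0)
  obtain ⟨ε, hε, hεu⟩ := mem_nhdsGT_iff_exists_Ioo_subset.1 hev
  have hε : 0 < ε := hε
  have hεp : ε ≤ p := by
    by_contra hlt
    exact hεu ⟨hp, not_le.1 hlt⟩ hup
  have hcomp : IsCompact (Set.Icc ε p ∩ u ⁻¹' {0}) :=
    isCompact_Icc.inter_right (isClosed_singleton.preimage hu)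
  obtain ⟨r, hr⟩ := hcomp.exists_isLeast ⟨p, ⟨hεp, le_rfl⟩, hup⟩
  refine ⟨r, hε.trans_le hr.1.1.1, hr.1.1.2, hr.1.2, fun x hx hxr hx0 => ?_⟩
  rcases lt_or_ge x ε with h | h
  · exact hεu ⟨hx, h⟩ hx0
  · exact absurd (hr.2 ⟨⟨h, hxr.le.trans hr.1.1.2⟩, hx0⟩) (not_le.2 hxr)

/-- A solution that satisfies a Dirichlet or Neumann condition at `0` and vanishes not later than a
Neumann solution for a larger eigenvalue is zero. -/
theorem eq_zero_of_zero_of_sturm (hM : ∀ x, |Q x - ν| ≤ M) {p : ℝ} (hp : 0 < p)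
    (hf : SolvesODE (fun x => Q x - ν) f f')
    (hψ : SolvesODE (fun x => Q x - μ) ψ ψ') (hψ0 : ψ' 0 = 0)
    (hψpos : ∀ x, 0 ≤ x → x < p → 0 < ψ x) (hfp : f p = 0)
    (hbc : (f 0 = 0 ∧ ν ≤ μ) ∨ (f' 0 = 0 ∧ ν < μ)) : ∀ x, f x = 0 := by
  by_contra hne
  have hinit : f 0 ≠ 0 ∨ f' 0 ≠ 0 := by
    by_contra! h
    exact hne (hf.eq_zero_of_initial hM h.1 h.2)
  obtain ⟨r, hr, hrp, hfr, hrne⟩ := exists_first_zero hf.continuous (hf 0).1 hinit hp hfp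
  have hψr : ∀ x, 0 ≤ x → x < r → 0 < ψ x := fun x h1 h2 => hψpos x h1 (h2.trans_le hrp)
  have hsign : (∀ x, 0 < x → x < r → 0 < f x) ∨ (∀ x, 0 < x → x < r → 0 < -f x) := by
    by_contra! h
    obtain ⟨⟨x, hx0, hxr, hx⟩, ⟨y, hy0, hyr, hy⟩⟩ := h
    have := (isPreconnected_Ioo (a := (0 : ℝ)) (b := r)).intermediate_value₂ (f := f)
      (g := fun _ => 0) (a := x) (b := y) ⟨hx0, hxr⟩ ⟨hy0, hyr⟩ hf.continuous.continuousOn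
      continuousOn_const hx (by linarith)
    obtain ⟨t, ht, ht0⟩ := this
    exact hrne t ht.1 ht.2 ht0
  rcases hsign with h | h
  · exact sturm_comparison_pos hr hf hψ hψ0 hψr hfr h hinit hbc
  · refine sturm_comparison_pos hr hf.neg hψ hψ0 hψr (by simp [hfr]) h (by simpa using hinit) ?_
    simpa using hbc

/-- A Dirichlet or Neumann solution on `[0, H]` that belongs neither to the ground state `g` nor to
an eigenvalue above that of the Neumann solution `ψ` with one zero is zero. -/
theorem eq_zero_of_ne_ground (hM : ∀ x, |Q x - ν| ≤ M) (hz : 0 < z) (hzH : z < H)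
    (hf : SolvesODE (fun x => Q x - ν) f f')
    (hg : SolvesODE (fun x => Q x - l) g g') (hgpos : ∀ x, 0 < x → x < H → 0 < g x) (hne : ν ≠ l)
    (hψ : SolvesODE (fun x => Q x - μ) ψ ψ') (hψ0 : ψ' 0 = 0) (hψH : ψ' H = 0)
    (hψpos : ∀ x, 0 ≤ x → x < z → 0 < ψ x) (hψneg : ∀ x, z < x → x ≤ H → ψ x < 0)
    (hbc : (f 0 = 0 ∧ f H = 0 ∧ g 0 = 0 ∧ g H = 0 ∧ ν ≤ μ) ∨
      (f' 0 = 0 ∧ f' H = 0 ∧ g' 0 = 0 ∧ g' H = 0 ∧ ν < μ)) : ∀ x, f x = 0 := by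
  obtain ⟨p, hp, hpH, hfp⟩ := exists_zero_of_wronskian_boundary (hz.trans hzH) hf hg hne hgpos
    (by rcases hbc with h | h <;> simp [h.1, h.2.2.1])
    (by rcases hbc with h | h <;> simp [h.2.1, h.2.2.2.1])
  rcases le_or_gt p z with hpz | hpz
  · refine eq_zero_of_zero_of_sturm hM hp hf hψ hψ0
      (fun x h1 h2 => hψpos x h1 (h2.trans_le hpz)) hfp ?_
    rcases hbc with h | h
    · exact Or.inl ⟨h.1, h.2.2.2.2⟩
    · exact Or.inr ⟨h.1, h.2.2.2.2⟩
  -- A zero beyond `z` is treated from the other end: after `x ↦ H - x`, the positive Neumann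
  -- solution is `-ψ`.
  · have key := eq_zero_of_zero_of_sturm (Q := fun x => Q (H - x)) (fun x => hM (H - x))
      (p := H - p) (by linarith) (hf.comp_const_sub H) (hψ.comp_const_sub H).neg
      (by simp [hψH]) (fun x h1 h2 => by
        have := hψneg (H - x) (by linarith) (by linarith)
        linarith)
      (by simp [hfp]) (by
        rcases hbc with h | h
        · exact Or.inl ⟨by simp [h.2.1], h.2.2.2.2⟩
        · exact Or.inr ⟨by simp [h.2.1], h.2.2.2.2⟩)
    intro x
    simpa using key (H - x)

/-! ### Periodic eigenfunctions of an even periodic potential -/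

theorem solvesODE_of_mem {L : ℝ} (h : f ∈ periodicEigenspace Q L ν) :
    SolvesODE (fun x => Q x - ν) f (deriv f) := by
  obtain ⟨hc, he, -, -⟩ := h
  intro x
  have d1 : Differentiable ℝ f := hc.differentiable (by norm_num)
  have d2 : Differentiable ℝ (deriv f) := (hc.iterate_deriv' 1 1).differentiable (by norm_num)
  refine ⟨(d1 x).hasDerivAt, (d2 x).hasDerivAt.congr_deriv ?_⟩
  have := he x
  simp only [schrodingerOp] at this
  linarith

theorem SolvesODE.mem_periodicEigenspace {L : ℝ} (hQ : Continuous Q)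
    (h : SolvesODE (fun x => Q x - ν) f f') (h0 : f 0 = f L) (h1 : f' 0 = f' L) :
    f ∈ periodicEigenspace Q L ν := by
  have e1 : deriv f = f' := funext fun x => (h x).1.deriv
  have e2 : deriv f' = fun x => (Q x - ν) * f x := funext fun x => (h x).2.deriv
  refine ⟨?_, fun x => ?_, h0, by rw [e1, h1]⟩
  · have c1 : ContDiff ℝ 1 f' := by
      refine contDiff_one_iff_deriv.2 ⟨fun x => (h x).2.differentiableAt, ?_⟩
      rw [e2]
      exact (hQ.sub continuous_const).mul h.continuous
    have : ContDiff ℝ (1 + 1) f :=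
      contDiff_succ_iff_deriv.2 ⟨fun x => (h x).1.differentiableAt, by simp, by rwa [e1]⟩
    exact this.of_le (by norm_num)
  · simp only [schrodingerOp, e1, e2]
    ring

/-- Even and odd parts of a periodic eigenfunction solve the Neumann and the Dirichlet problem on
the half period. -/
theorem even_odd_parts {L : ℝ} (hM : ∀ x, |Q x - ν| ≤ M) (heven : ∀ x, Q (-x) = Q x)
    (hper : ∀ x, Q (x + L) = Q x) (hf : f ∈ periodicEigenspace Q L ν) :
    (SolvesODE (fun x => Q x - ν) (fun x => f x + f (-x)) (fun x => deriv f x - deriv f (-x)) ∧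
      deriv f (L / 2) - deriv f (-(L / 2)) = 0) ∧
    (SolvesODE (fun x => Q x - ν) (fun x => f x - f (-x)) (fun x => deriv f x + deriv f (-x)) ∧
      f (L / 2) - f (-(L / 2)) = 0) := by
  have hs := solvesODE_of_mem hf
  have hr : SolvesODE (fun x => Q x - ν) (fun x => f (-x)) (fun x => -deriv f (-x)) := by
    have := hs.comp_const_sub 0
    simp only [zero_sub, heven] at this
    exact this
  have ht : SolvesODE (fun x => Q x - ν) (fun x => f (x + L)) (fun x => deriv f (x + L)) := by
    have := hs.comp_add_const L
    simp only [hper] at this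
    exact this
  -- The two boundary conditions say that `f` and its translate have the same initial data at `0`,
  -- so uniqueness makes `f` periodic on the whole line.
  have hpf : ∀ x, f (x + L) = f x :=
    ht.eq_of_initial hM hs (x₀ := 0) (by simpa using hf.2.2.1.symm)
      (by simpa using hf.2.2.2.symm)
  have hpd : ∀ x, deriv f (x + L) = deriv f x := fun x => by
    have h1 := (ht x).1
    rw [funext hpf] at h1
    exact h1.unique (hs x).1
  have e : -(L / 2) + L = L / 2 := by ring
  refine ⟨⟨?_, ?_⟩, ⟨?_, ?_⟩⟩
  · simpa only [sub_eq_add_neg] using hs.add hr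
  · have := hpd (-(L / 2))
    rw [e] at this
    linarith
  · simpa only [sub_eq_add_neg, neg_neg] using hs.add hr.neg
  · have := hpf (-(L / 2))
    rw [e] at this
    linarith

theorem eigenMultiplicity_eq_one {L : ℝ} (hψ : ψ ∈ periodicEigenspace Q L ν)
    (hne : ∃ x, ψ x ≠ 0) (h : ∀ f ∈ periodicEigenspace Q L ν, ∃ a : ℝ, ∀ x, f x = a * ψ x) :
    eigenMultiplicity Q L ν = 1 := by
  refine finrank_eq_one_iff'.2 ⟨⟨ψ, hψ⟩, ?_, ?_⟩
  · intro h0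
    obtain ⟨x, hx⟩ := hne
    exact hx (congrFun (congrArg Subtype.val h0) x)
  · rintro ⟨f, hf⟩
    obtain ⟨a, ha⟩ := h f hf
    exact ⟨a, Subtype.ext (funext fun x => by simp [ha])⟩

theorem isPeriodicEigenvalue_of_mem {L : ℝ} (hψ : ψ ∈ periodicEigenspace Q L ν)
    (hne : ∃ x, ψ x ≠ 0) : IsPeriodicEigenvalue Q L ν := by
  intro h
  rw [h, Submodule.mem_bot] at hψ
  obtain ⟨x, hx⟩ := hne
  exact hx (congrFun hψ x)

/-- If the odd parts of all eigenfunctions vanish, the eigenvalue is simple. -/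
theorem eigenMultiplicity_eq_one_of_even {L : ℝ} (hM : ∀ x, |Q x - ν| ≤ M)
    (hψ : SolvesODE (fun x => Q x - ν) ψ ψ') (hψ0 : ψ' 0 = 0) (hψ1 : ψ 0 ≠ 0)
    (hmem : ψ ∈ periodicEigenspace Q L ν)
    (h : ∀ f ∈ periodicEigenspace Q L ν, ∀ x, f x - f (-x) = 0) :
    eigenMultiplicity Q L ν = 1 := by
  refine eigenMultiplicity_eq_one hmem ⟨0, hψ1⟩ fun f hf => ⟨f 0 / ψ 0, ?_⟩
  have hs := solvesODE_of_mem hf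
  -- An even solution has zero slope at `0`, so `f 0` alone determines it.
  have hd : deriv f 0 = 0 := by
    have e : (fun x => f (-x)) = f := funext fun x => by linarith [h f hf x]
    have h1 := deriv_comp_neg f 0
    rw [e, neg_zero] at h1
    linarith
  exact hs.eq_of_initial hM (hψ.const_mul (f 0 / ψ 0)) (x₀ := 0) (by field_simp)
    (by simp [hd, hψ0])

/-- If the even parts of all eigenfunctions vanish, the eigenvalue is simple. -/
theorem eigenMultiplicity_eq_one_of_odd {L : ℝ} (hM : ∀ x, |Q x - ν| ≤ M)
    (hψ : SolvesODE (fun x => Q x - ν) ψ ψ') (hψ0 : ψ 0 = 0) (hψ1 : ψ' 0 ≠ 0)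
    (hmem : ψ ∈ periodicEigenspace Q L ν) (hne : ∃ x, ψ x ≠ 0)
    (h : ∀ f ∈ periodicEigenspace Q L ν, ∀ x, f x + f (-x) = 0) :
    eigenMultiplicity Q L ν = 1 := by
  refine eigenMultiplicity_eq_one hmem hne fun f hf => ⟨deriv f 0 / ψ' 0, ?_⟩
  have h0 := h f hf 0
  rw [neg_zero] at h0
  exact (solvesODE_of_mem hf).eq_of_initial hM (hψ.const_mul (deriv f 0 / ψ' 0)) (x₀ := 0)
    (by rw [hψ0]; linarith) (by field_simp)

theorem not_isPeriodicEigenvalue {L : ℝ}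
    (h0 : ∀ f ∈ periodicEigenspace Q L ν, ∀ x, f x + f (-x) = 0)
    (h1 : ∀ f ∈ periodicEigenspace Q L ν, ∀ x, f x - f (-x) = 0) :
    ¬ IsPeriodicEigenvalue Q L ν := by
  intro h
  refine h ((Submodule.eq_bot_iff _).2 fun f hf => funext fun x => ?_)
  have := h0 f hf x
  have := h1 f hf x
  simp only [Pi.zero_apply]
  linarith

/-! ### The Jacobi elliptic functions -/

section Jacobi

variable {κ : ℝ}

/-- Substitute `t = sin s`. Open intervals avoid the endpoint `s = π / 2`, where the cosine to be
cancelled vanishes. -/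
theorem ellipticK_eq_ellipticF (h0 : 0 ≤ κ) (h1 : κ < 1) :
    ellipticK κ = ellipticF κ (Real.pi / 2) := by
  have hpi := Real.pi_pos
  have himg : Real.sin '' Set.Ioo 0 (Real.pi / 2) = Set.Ioo 0 1 := by
    ext t
    constructor
    · rintro ⟨s, hs, rfl⟩
      refine ⟨Real.sin_pos_of_pos_of_lt_pi hs.1 (by linarith [hs.2]), ?_⟩
      have := Real.strictMonoOn_sin (a := s) (b := Real.pi / 2)
        ⟨by linarith [hs.1], hs.2.le⟩ ⟨by linarith, le_rfl⟩ hs.2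
      simpa using this
    · intro ht
      exact ⟨Real.arcsin t, ⟨Real.arcsin_pos.2 ht.1, Real.arcsin_lt_pi_div_two.2 ht.2⟩,
        Real.sin_arcsin (by linarith [ht.1]) ht.2.le⟩
  have hinj : Set.InjOn Real.sin (Set.Ioo 0 (Real.pi / 2)) :=
    Real.injOn_sin.mono fun s (hs : 0 < s ∧ s < Real.pi / 2) =>
      Set.mem_Icc.2 ⟨by linarith [hs.1], hs.2.le⟩
  unfold ellipticK ellipticF
  rw [intervalIntegral.integral_of_le zero_le_one,
    intervalIntegral.integral_of_le (by positivity),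
    MeasureTheory.integral_Ioc_eq_integral_Ioo, MeasureTheory.integral_Ioc_eq_integral_Ioo, ← himg,
    MeasureTheory.integral_image_eq_integral_abs_deriv_smul measurableSet_Ioo
      (fun s _ => (Real.hasDerivAt_sin s).hasDerivWithinAt) hinj]
  refine MeasureTheory.setIntegral_congr_fun measurableSet_Ioo fun s hs => ?_
  have hcos : 0 < Real.cos s := Real.cos_pos_of_mem_Ioo ⟨by linarith [hs.1], hs.2⟩
  have hr := Real.sqrt_pos.2 (ellipticF_radicand_pos h0 h1 s)
  have e : 1 - Real.sin s ^ 2 = Real.cos s ^ 2 := by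
    linarith [Real.sin_sq_add_cos_sq s]
  simp only [smul_eq_mul]
  rw [e, Real.sqrt_mul (sq_nonneg _), Real.sqrt_sq hcos.le, abs_of_pos hcos]
  field_simp

theorem ellipticF_strictMono (h0 : 0 ≤ κ) (h1 : κ < 1) : StrictMono (ellipticF κ) := by
  intro a b hab
  have := ellipticF_expand h0 h1 hab.le
  linarith

theorem ellipticF_zero : ellipticF κ 0 = 0 := by simp [ellipticF]

theorem ellipticF_neg (θ : ℝ) : ellipticF κ (-θ) = -ellipticF κ θ := by
  unfold ellipticF
  have h := intervalIntegral.integral_comp_neg (a := -θ) (b := 0)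
    (fun s : ℝ => 1 / Real.sqrt (1 - κ ^ 2 * Real.sin s ^ 2))
  simp only [Real.sin_neg, neg_sq, neg_zero, neg_neg] at h
  rw [intervalIntegral.integral_symm, h]

/-- The integrand has period `π`, so its integral over one period may be taken over `[-π/2, π/2]`,
where oddness of `ellipticF` doubles the quarter-period value. -/
theorem ellipticF_add_pi (h0 : 0 ≤ κ) (h1 : κ < 1) (θ : ℝ) :
    ellipticF κ (θ + Real.pi) = ellipticF κ θ + 2 * ellipticF κ (Real.pi / 2) := by
  have hc := ellipticF_continuous_integrand h0 h1
  have hper : Function.Periodic (fun s : ℝ => 1 / Real.sqrt (1 - κ ^ 2 * Real.sin s ^ 2))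
      Real.pi := fun s => by simp [Real.sin_add_pi]
  have hsub : ∀ a b, ellipticF κ b - ellipticF κ a =
      ∫ s in a..b, 1 / Real.sqrt (1 - κ ^ 2 * Real.sin s ^ 2) := fun a b =>
    intervalIntegral.integral_interval_sub_left (hc.intervalIntegrable _ _)
      (hc.intervalIntegrable _ _)
  have h2 := hper.intervalIntegral_add_eq θ (-(Real.pi / 2))
  rw [← hsub, ← hsub, ellipticF_neg,
    show -(Real.pi / 2) + Real.pi = Real.pi / 2 by ring] at h2
  linarith

theorem jacobiAm_ellipticF (h0 : 0 ≤ κ) (h1 : κ < 1) (θ : ℝ) :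
    jacobiAm κ (ellipticF κ θ) = θ :=
  Function.leftInverse_invFun (ellipticF_bijective h0 h1).injective θ

theorem jacobiAm_strictMono (h0 : 0 ≤ κ) (h1 : κ < 1) : StrictMono (jacobiAm κ) := by
  intro u v huv
  rw [← (ellipticF_strictMono h0 h1).lt_iff_lt, ellipticF_jacobiAm h0 h1,
    ellipticF_jacobiAm h0 h1]
  exact huv

theorem jacobiAm_continuous (h0 : 0 ≤ κ) (h1 : κ < 1) : Continuous (jacobiAm κ) :=
  (jacobiAm_strictMono h0 h1).monotone.continuous_of_surjective
    fun θ => ⟨_, jacobiAm_ellipticF h0 h1 θ⟩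

theorem jacobiAm_zero (h0 : 0 ≤ κ) (h1 : κ < 1) : jacobiAm κ 0 = 0 := by
  simpa [ellipticF_zero] using jacobiAm_ellipticF h0 h1 0

theorem jacobiAm_ellipticK (h0 : 0 ≤ κ) (h1 : κ < 1) :
    jacobiAm κ (ellipticK κ) = Real.pi / 2 := by
  rw [ellipticK_eq_ellipticF h0 h1, jacobiAm_ellipticF h0 h1]

theorem jacobiAm_neg (h0 : 0 ≤ κ) (h1 : κ < 1) (u : ℝ) : jacobiAm κ (-u) = -jacobiAm κ u := by
  apply (ellipticF_bijective h0 h1).injective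
  rw [ellipticF_neg, ellipticF_jacobiAm h0 h1, ellipticF_jacobiAm h0 h1]

theorem jacobiAm_add_two_mul_ellipticK (h0 : 0 ≤ κ) (h1 : κ < 1) (u : ℝ) :
    jacobiAm κ (u + 2 * ellipticK κ) = jacobiAm κ u + Real.pi := by
  apply (ellipticF_bijective h0 h1).injective
  rw [ellipticF_add_pi h0 h1, ellipticF_jacobiAm h0 h1, ellipticF_jacobiAm h0 h1,
    ellipticK_eq_ellipticF h0 h1]

theorem jacobiDn_pos (h0 : 0 ≤ κ) (h1 : κ < 1) (u : ℝ) : 0 < jacobiDn κ u :=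
  Real.sqrt_pos.2 (ellipticF_radicand_pos h0 h1 _)

theorem jacobiDn_sq (h0 : 0 ≤ κ) (h1 : κ < 1) (u : ℝ) :
    jacobiDn κ u ^ 2 = 1 - κ ^ 2 * Real.sin (jacobiAm κ u) ^ 2 :=
  Real.sq_sqrt (ellipticF_radicand_pos h0 h1 _).le

theorem jacobiDn_zero (h0 : 0 ≤ κ) (h1 : κ < 1) : jacobiDn κ 0 = 1 := by
  simp [jacobiDn, jacobiAm_zero h0 h1]

theorem jacobiDn_neg (h0 : 0 ≤ κ) (h1 : κ < 1) (u : ℝ) : jacobiDn κ (-u) = jacobiDn κ u := by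
  simp [jacobiDn, jacobiAm_neg h0 h1]

theorem jacobiDn_add_two_mul_ellipticK (h0 : 0 ≤ κ) (h1 : κ < 1) (u : ℝ) :
    jacobiDn κ (u + 2 * ellipticK κ) = jacobiDn κ u := by
  simp [jacobiDn, jacobiAm_add_two_mul_ellipticK h0 h1, Real.sin_add_pi]

theorem hasDerivAt_jacobiAm (h0 : 0 ≤ κ) (h1 : κ < 1) (u : ℝ) :
    HasDerivAt (jacobiAm κ) (jacobiDn κ u) u := by
  have hF : HasDerivAt (ellipticF κ) (jacobiDn κ u)⁻¹ (jacobiAm κ u) := by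
    have hc := ellipticF_continuous_integrand h0 h1
    have := intervalIntegral.integral_hasDerivAt_right (hc.intervalIntegrable 0 (jacobiAm κ u))
      hc.aestronglyMeasurable.stronglyMeasurableAtFilter hc.continuousAt
    exact this.congr_deriv (one_div _)
  have := HasDerivAt.of_local_left_inverse (jacobiAm_continuous h0 h1).continuousAt hF
    (inv_ne_zero (jacobiDn_pos h0 h1 u).ne')
    (Filter.Eventually.of_forall fun v => ellipticF_jacobiAm h0 h1 v)
  simpa using this

/-- The derivative `-κ² sn cn` of `dn`. -/
noncomputable def jacobiDnDeriv (κ u : ℝ) : ℝ :=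
  -κ ^ 2 * (Real.sin (jacobiAm κ u) * Real.cos (jacobiAm κ u))

theorem hasDerivAt_jacobiDn (h0 : 0 ≤ κ) (h1 : κ < 1) (u : ℝ) :
    HasDerivAt (jacobiDn κ) (jacobiDnDeriv κ u) u := by
  have hd := jacobiDn_pos h0 h1 u
  have hs := (hasDerivAt_jacobiAm h0 h1 u).sin
  have := (((hs.pow 2).const_mul (κ ^ 2)).const_sub 1).sqrt
    (ellipticF_radicand_pos h0 h1 _).ne'
  refine this.congr_deriv ?_
  have e : Real.sqrt (1 - κ ^ 2 * (Real.sin (jacobiAm κ u)) ^ 2) = jacobiDn κ u := rfl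
  simp only [jacobiDnDeriv, Pi.pow_apply, e]
  field_simp
  push_cast
  ring

theorem hasDerivAt_jacobiDnDeriv (h0 : 0 ≤ κ) (h1 : κ < 1) (u : ℝ) :
    HasDerivAt (jacobiDnDeriv κ) ((2 - κ ^ 2) * jacobiDn κ u - 2 * jacobiDn κ u ^ 3) u := by
  have ha := hasDerivAt_jacobiAm h0 h1 u
  refine ((ha.sin.mul ha.cos).const_mul (-κ ^ 2)).congr_deriv ?_
  have e := jacobiDn_sq h0 h1 u
  have e' := Real.sin_sq_add_cos_sq (jacobiAm κ u)
  linear_combination (2 * jacobiDn κ u) * e - (κ ^ 2 * jacobiDn κ u) * e'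

/-- This is the first integral of the equation for `dn`; it becomes `deriv_sq` after scaling. -/
theorem jacobiDnDeriv_sq (h0 : 0 ≤ κ) (h1 : κ < 1) (u : ℝ) :
    jacobiDnDeriv κ u ^ 2 = (1 - jacobiDn κ u ^ 2) * (jacobiDn κ u ^ 2 - (1 - κ ^ 2)) := by
  rw [jacobiDn_sq h0 h1, jacobiDnDeriv, mul_pow, mul_pow, Real.cos_sq']
  ring

theorem jacobiDnDeriv_zero (h0 : 0 ≤ κ) (h1 : κ < 1) : jacobiDnDeriv κ 0 = 0 := by
  simp [jacobiDnDeriv, jacobiAm_zero h0 h1]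

theorem jacobiDnDeriv_ellipticK (h0 : 0 ≤ κ) (h1 : κ < 1) :
    jacobiDnDeriv κ (ellipticK κ) = 0 := by
  simp [jacobiDnDeriv, jacobiAm_ellipticK h0 h1]

theorem jacobiDnDeriv_neg_of_mem (h0 : 0 < κ) (h1 : κ < 1) {u : ℝ} (hu : 0 < u)
    (huK : u < ellipticK κ) : jacobiDnDeriv κ u < 0 := by
  have m := jacobiAm_strictMono h0.le h1
  have a1 := m hu
  have a2 := m huK
  rw [jacobiAm_zero h0.le h1] at a1
  rw [jacobiAm_ellipticK h0.le h1] at a2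
  have hs := Real.sin_pos_of_pos_of_lt_pi a1 (by linarith [Real.pi_pos])
  have hc := Real.cos_pos_of_mem_Ioo ⟨by linarith [Real.pi_pos], a2⟩
  have := mul_pos (pow_pos h0 2) (mul_pos hs hc)
  simp only [jacobiDnDeriv]
  linarith

end Jacobi

/-! ### Spectra of the linearised operators at a dnoidal profile -/

/-- The properties of `y(x) = η₁ dn(η₁ x / √2; κ)`, of period `2 H`, that determine the spectra of
`-∂² + σ - 3 y²` and `-∂² + σ - y²`. -/
structure IsDnoidalProfile (η₁ η₂ σ H : ℝ) (y y' : ℝ → ℝ) : Prop where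
  half_period_pos : 0 < H
  eta₂_pos : 0 < η₂
  eta₂_lt : η₂ < η₁
  sum_sq : η₁ ^ 2 + η₂ ^ 2 = 2 * σ
  hasDerivAt : ∀ x, HasDerivAt y (y' x) x
  hasDerivAt_deriv : ∀ x, HasDerivAt y' (σ * y x - y x ^ 3) x
  deriv_sq : ∀ x, 2 * y' x ^ 2 = (η₁ ^ 2 - y x ^ 2) * (y x ^ 2 - η₂ ^ 2)
  pos : ∀ x, 0 < y x
  even : ∀ x, y (-x) = y x
  periodic : ∀ x, y (x + 2 * H) = y x
  apply_zero : y 0 = η₁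
  deriv_zero : y' 0 = 0
  deriv_half : y' H = 0
  deriv_neg : ∀ x, 0 < x → x < H → y' x < 0

namespace IsDnoidalProfile

variable {η₁ η₂ σ H : ℝ} {y y' : ℝ → ℝ}

theorem continuous (h : IsDnoidalProfile η₁ η₂ σ H y y') : Continuous y :=
  continuous_iff_continuousAt.2 fun x => (h.hasDerivAt x).continuousAt

theorem deriv_periodic (h : IsDnoidalProfile η₁ η₂ σ H y y') (x : ℝ) :
    y' (x + 2 * H) = y' x := by
  have h1 := (h.hasDerivAt (x + 2 * H)).comp_add_const x (2 * H)
  rw [funext h.periodic] at h1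
  exact h1.unique (h.hasDerivAt x)

/-- The product in `deriv_sq` is nonnegative, so `y²` lies between its two roots. -/
theorem sq_le (h : IsDnoidalProfile η₁ η₂ σ H y y') (x : ℝ) :
    η₂ ^ 2 ≤ y x ^ 2 ∧ y x ^ 2 ≤ η₁ ^ 2 := by
  have h1 := h.deriv_sq x
  have h2 : η₂ ^ 2 < η₁ ^ 2 := by nlinarith [h.eta₂_pos, h.eta₂_lt]
  have h3 := sq_nonneg (y' x)
  constructor <;> by_contra! h4 <;> nlinarith

theorem strictAntiOn (h : IsDnoidalProfile η₁ η₂ σ H y y') :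
    StrictAntiOn y (Set.Icc 0 H) := by
  refine strictAntiOn_of_deriv_neg (convex_Icc 0 H) h.continuous.continuousOn fun x hx => ?_
  rw [interior_Icc] at hx
  rw [(h.hasDerivAt x).deriv]
  exact h.deriv_neg x hx.1 hx.2

/-- The first integral vanishes at `H`, and strict decrease from `η₁` rules out its first factor. -/
theorem apply_half_sq (h : IsDnoidalProfile η₁ η₂ σ H y y') : y H ^ 2 = η₂ ^ 2 := by
  have h1 := h.deriv_sq H
  have h2 := h.strictAntiOn (Set.left_mem_Icc.2 h.half_period_pos.le)
    (Set.right_mem_Icc.2 h.half_period_pos.le) h.half_period_pos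
  rw [h.apply_zero] at h2
  rw [h.deriv_half] at h1
  have h3 : η₁ ^ 2 - y H ^ 2 ≠ 0 := by
    have := h.pos H
    nlinarith
  have h4 : y H ^ 2 - η₂ ^ 2 = 0 := by
    refine (mul_eq_zero.1 ?_).resolve_left h3
    rw [← h1]
    ring
  linarith

theorem abs_potential_le (h : IsDnoidalProfile η₁ η₂ σ H y y') (k ν x : ℝ) :
    |σ - k * y x ^ 2 - ν| ≤ |σ - ν| + |k| * η₁ ^ 2 := by
  have e : σ - k * y x ^ 2 - ν = (σ - ν) - k * y x ^ 2 := by ring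
  rw [e]
  refine (abs_sub _ _).trans ?_
  rw [abs_mul, abs_of_nonneg (sq_nonneg (y x))]
  have := mul_le_mul_of_nonneg_left (h.sq_le x).2 (abs_nonneg k)
  linarith

theorem continuous_potential (h : IsDnoidalProfile η₁ η₂ σ H y y') (k : ℝ) :
    Continuous fun x => σ - k * y x ^ 2 :=
  continuous_const.sub (continuous_const.mul (h.continuous.pow 2))

theorem solvesODE (h : IsDnoidalProfile η₁ η₂ σ H y y') :
    SolvesODE (fun x => σ - 1 * y x ^ 2 - 0) y y' := fun x =>
  ⟨h.hasDerivAt x, (h.hasDerivAt_deriv x).congr_deriv (by ring)⟩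

/-- Differentiating `y'' = σ y - y³` gives the linearised equation. -/
theorem solvesODE_deriv (h : IsDnoidalProfile η₁ η₂ σ H y y') :
    SolvesODE (fun x => σ - 3 * y x ^ 2 - 0) y' (fun x => σ * y x - y x ^ 3) := fun x =>
  ⟨h.hasDerivAt_deriv x,
    (((h.hasDerivAt x).const_mul σ).sub ((h.hasDerivAt x).pow 3)).congr_deriv
      (by push_cast; ring)⟩

/-- The first integral turns `(y²)''` into `-3y⁴ + 4σy² - η₁²η₂²`. Matching this with the potential
times `y² - r` fixes the eigenvalue through the coefficient of `y²` and the quadratic for `r`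
through the constant term. -/
theorem solvesODE_sq_sub (h : IsDnoidalProfile η₁ η₂ σ H y y') {r : ℝ}
    (hr : 3 * r ^ 2 - 4 * σ * r + η₁ ^ 2 * η₂ ^ 2 = 0) :
    SolvesODE (fun x => σ - 3 * y x ^ 2 - 3 * (r - σ)) (fun x => y x ^ 2 - r)
      (fun x => 2 * (y x * y' x)) := fun x => by
  refine ⟨(((h.hasDerivAt x).pow 2).sub_const r).congr_deriv (by push_cast; ring),
    (((h.hasDerivAt x).mul (h.hasDerivAt_deriv x)).const_mul 2).congr_deriv ?_⟩
  have h1 := h.deriv_sq x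
  have h2 := h.sum_sq
  linear_combination h1 + y x ^ 2 * h2 - hr

theorem mem_periodicEigenspace (h : IsDnoidalProfile η₁ η₂ σ H y y') :
    y ∈ periodicEigenspace (fun x => σ - 1 * y x ^ 2) (2 * H) 0 := by
  have h0 := h.periodic 0
  have h1 := h.deriv_periodic 0
  rw [zero_add] at h0 h1
  exact h.solvesODE.mem_periodicEigenspace (h.continuous_potential 1) h0.symm h1.symm

theorem deriv_mem_periodicEigenspace (h : IsDnoidalProfile η₁ η₂ σ H y y') :
    y' ∈ periodicEigenspace (fun x => σ - 3 * y x ^ 2) (2 * H) 0 := by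
  have h0 := h.periodic 0
  have h1 := h.deriv_periodic 0
  rw [zero_add] at h0 h1
  exact h.solvesODE_deriv.mem_periodicEigenspace (h.continuous_potential 3) h1.symm
    (by simp only [h0])

theorem sq_sub_mem_periodicEigenspace (h : IsDnoidalProfile η₁ η₂ σ H y y') {r : ℝ}
    (hr : 3 * r ^ 2 - 4 * σ * r + η₁ ^ 2 * η₂ ^ 2 = 0) :
    (fun x => y x ^ 2 - r) ∈
      periodicEigenspace (fun x => σ - 3 * y x ^ 2) (2 * H) (3 * (r - σ)) := by
  have h0 := h.periodic 0
  have h1 := h.deriv_periodic 0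
  rw [zero_add] at h0 h1
  exact (h.solvesODE_sq_sub hr).mem_periodicEigenspace (h.continuous_potential 3)
    (by simp only [h0]) (by simp only [h0, h1])

/-- With `a = η₁²` and `b = η₂²`, the quadratic is negative at `b` and at `σ = (a + b) / 2` and
positive at `a`, which lies to the right of its vertex. The position of `r₀` makes `y² - r₀`
positive, that of `r₂` gives `y² - r₂` a sign change, and `σ` separates the signs of the
eigenvalues. -/
theorem exists_roots (h : IsDnoidalProfile η₁ η₂ σ H y y') :
    ∃ r₀ r₂ : ℝ, 3 * r₀ ^ 2 - 4 * σ * r₀ + η₁ ^ 2 * η₂ ^ 2 = 0 ∧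
      3 * r₂ ^ 2 - 4 * σ * r₂ + η₁ ^ 2 * η₂ ^ 2 = 0 ∧ r₀ < η₂ ^ 2 ∧ η₂ ^ 2 < r₂ ∧
      r₂ < η₁ ^ 2 ∧ r₀ < σ ∧ σ < r₂ := by
  have hb : 0 < η₂ ^ 2 := pow_pos h.eta₂_pos 2
  have hab : η₂ ^ 2 < η₁ ^ 2 := by nlinarith [h.eta₂_pos, h.eta₂_lt]
  have hs := h.sum_sq
  generalize η₁ ^ 2 = a at *
  generalize η₂ ^ 2 = b at *
  obtain rfl : σ = (a + b) / 2 := by linarith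
  have hD : 0 ≤ (a + b) ^ 2 - 3 * (a * b) := by nlinarith [mul_pos hb (hb.trans hab)]
  have hsq := Real.sq_sqrt hD
  have hnn := Real.sqrt_nonneg ((a + b) ^ 2 - 3 * (a * b))
  set s := Real.sqrt ((a + b) ^ 2 - 3 * (a * b))
  -- These three bounds on the root of the discriminant amount to `σ < r₂`, `r₀ < b` and `r₂ < a`.
  have h1 : (a + b) / 2 < s := by
    by_contra! h1
    nlinarith [sq_pos_of_pos (sub_pos.2 hab)]
  have h2 : a - 2 * b < s := by
    by_contra! h2
    nlinarith [mul_pos hb (sub_pos.2 hab)]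
  have h3 : s < 2 * a - b := by
    by_contra! h3
    nlinarith [mul_pos (hb.trans hab) (sub_pos.2 hab)]
  refine ⟨(a + b - s) / 3, (a + b + s) / 3, ?_, ?_, ?_, ?_, ?_, ?_, ?_⟩ <;>
    nlinarith

/-- The point where `y² - r` changes sign. -/
theorem exists_sign_change (h : IsDnoidalProfile η₁ η₂ σ H y y') {r : ℝ} (h2 : η₂ ^ 2 < r)
    (h1 : r < η₁ ^ 2) : ∃ z, 0 < z ∧ z < H ∧ (∀ x, 0 ≤ x → x < z → 0 < y x ^ 2 - r) ∧
      ∀ x, z < x → x ≤ H → y x ^ 2 - r < 0 := by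
  have hH := h.half_period_pos
  have ha : StrictAntiOn (fun x => y x ^ 2) (Set.Icc 0 H) := fun u hu v hv huv =>
    pow_lt_pow_left₀ (h.strictAntiOn hu hv huv) (h.pos v).le two_ne_zero
  obtain ⟨z, hz, hzr⟩ := intermediate_value_Ioo' hH.le (h.continuous.pow 2).continuousOn
    (show r ∈ Set.Ioo (y H ^ 2) (y 0 ^ 2) by
      rw [h.apply_half_sq, h.apply_zero]; exact ⟨h2, h1⟩)
  have hzr : y z ^ 2 = r := hzr
  have hz' : z ∈ Set.Icc 0 H := ⟨hz.1.le, hz.2.le⟩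
  refine ⟨z, hz.1, hz.2, fun x hx0 hxz => ?_, fun x hzx hxH => ?_⟩
  · have := ha ⟨hx0, (hxz.trans hz.2).le⟩ hz' hxz
    simp only at this
    linarith
  · have := ha hz' ⟨(hz.1.trans hzx).le, hxH⟩ hzx
    simp only at this
    linarith

theorem even_part_eq_zero₁ (h : IsDnoidalProfile η₁ η₂ σ H y y') {r₀ r₂ ν : ℝ}
    (hr₀ : 3 * r₀ ^ 2 - 4 * σ * r₀ + η₁ ^ 2 * η₂ ^ 2 = 0)
    (hr₂ : 3 * r₂ ^ 2 - 4 * σ * r₂ + η₁ ^ 2 * η₂ ^ 2 = 0)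
    (h0 : r₀ < η₂ ^ 2) (h2 : η₂ ^ 2 < r₂) (h1 : r₂ < η₁ ^ 2) (hν : ν ≠ 3 * (r₀ - σ))
    (hν2 : ν < 3 * (r₂ - σ)) {f : ℝ → ℝ}
    (hf : f ∈ periodicEigenspace (fun x => σ - 3 * y x ^ 2) (2 * H) ν) :
    ∀ x, f x + f (-x) = 0 := by
  obtain ⟨z, hz, hzH, hp, hn⟩ := h.exists_sign_change h2 h1
  obtain ⟨⟨hs, hb⟩, -⟩ := even_odd_parts (h.abs_potential_le 3 ν)
    (fun x => by rw [h.even]) (fun x => by rw [h.periodic]) hf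
  rw [mul_div_cancel_left₀ H two_ne_zero] at hb
  exact eq_zero_of_ne_ground (h.abs_potential_le 3 ν) hz hzH hs (h.solvesODE_sq_sub hr₀)
    (fun x _ _ => by have := (h.sq_le x).1; linarith) hν (h.solvesODE_sq_sub hr₂)
    (by simp [h.deriv_zero]) (by simp [h.deriv_half]) hp hn
    (Or.inr ⟨by simp, hb, by simp [h.deriv_zero], by simp [h.deriv_half], hν2⟩)

/-- The Dirichlet ground state is `-y'`, but the comparison function is still the Neumann solution
`y² - r₂`. This admits `ν = 3 (r₂ - σ)`, which is what makes the third eigenvalue simple. -/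
theorem odd_part_eq_zero₁ (h : IsDnoidalProfile η₁ η₂ σ H y y') {r₂ ν : ℝ}
    (hr₂ : 3 * r₂ ^ 2 - 4 * σ * r₂ + η₁ ^ 2 * η₂ ^ 2 = 0)
    (h2 : η₂ ^ 2 < r₂) (h1 : r₂ < η₁ ^ 2) (hν : ν ≠ 0)
    (hν2 : ν ≤ 3 * (r₂ - σ)) {f : ℝ → ℝ}
    (hf : f ∈ periodicEigenspace (fun x => σ - 3 * y x ^ 2) (2 * H) ν) :
    ∀ x, f x - f (-x) = 0 := by
  obtain ⟨z, hz, hzH, hp, hn⟩ := h.exists_sign_change h2 h1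
  obtain ⟨-, ⟨hs, hb⟩⟩ := even_odd_parts (h.abs_potential_le 3 ν)
    (fun x => by rw [h.even]) (fun x => by rw [h.periodic]) hf
  rw [mul_div_cancel_left₀ H two_ne_zero] at hb
  refine eq_zero_of_ne_ground (l := 0) (g := fun x => -y' x)
    (h.abs_potential_le 3 ν) hz hzH hs h.solvesODE_deriv.neg
    (fun x hx hxH => by have := h.deriv_neg x hx hxH; linarith) hν (h.solvesODE_sq_sub hr₂)
    (by simp [h.deriv_zero]) (by simp [h.deriv_half]) hp hn
    (Or.inl ⟨by simp, hb, by simp [h.deriv_zero], by simp [h.deriv_half], hν2⟩)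

theorem even_part_eq_zero₂ (h : IsDnoidalProfile η₁ η₂ σ H y y') {ν : ℝ} (hν : ν < 0)
    {f : ℝ → ℝ} (hf : f ∈ periodicEigenspace (fun x => σ - 1 * y x ^ 2) (2 * H) ν) :
    ∀ x, f x + f (-x) = 0 := by
  obtain ⟨⟨hs, hb⟩, -⟩ := even_odd_parts (h.abs_potential_le 1 ν)
    (fun x => by rw [h.even]) (fun x => by rw [h.periodic]) hf
  rw [mul_div_cancel_left₀ H two_ne_zero] at hb
  obtain ⟨p, hp, -, hfp⟩ := exists_zero_of_wronskian_boundary h.half_period_pos hs h.solvesODE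
    hν.ne (fun x _ _ => h.pos x) (by simp [h.deriv_zero]) (by simp [h.deriv_half, hb])
  exact eq_zero_of_zero_of_sturm (h.abs_potential_le 1 ν) hp hs h.solvesODE h.deriv_zero
    (fun x _ _ => h.pos x) hfp (Or.inr ⟨by simp, hν⟩)

/-- The Dirichlet condition at `H` already supplies the zero to compare with the positive Neumann
solution `y`, so no Wronskian argument is needed. -/
theorem odd_part_eq_zero₂ (h : IsDnoidalProfile η₁ η₂ σ H y y') {ν : ℝ} (hν : ν ≤ 0)
    {f : ℝ → ℝ} (hf : f ∈ periodicEigenspace (fun x => σ - 1 * y x ^ 2) (2 * H) ν) :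
    ∀ x, f x - f (-x) = 0 := by
  obtain ⟨-, ⟨hs, hb⟩⟩ := even_odd_parts (h.abs_potential_le 1 ν)
    (fun x => by rw [h.even]) (fun x => by rw [h.periodic]) hf
  rw [mul_div_cancel_left₀ H two_ne_zero] at hb
  exact eq_zero_of_zero_of_sturm (h.abs_potential_le 1 ν) h.half_period_pos hs h.solvesODE
    h.deriv_zero (fun x _ _ => h.pos x) hb (Or.inl ⟨by simp, hν⟩)

/-- The lowest eigenvalue of `-∂² + σ - y²` is `0`, and it is simple. -/
theorem spectrum₂ (h : IsDnoidalProfile η₁ η₂ σ H y y') :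
    IsNthEigenvalue (fun x => σ - 1 * y x ^ 2) (2 * H) 0 0 ∧
      eigenMultiplicity (fun x => σ - 1 * y x ^ 2) (2 * H) 0 = 1 := by
  have hm := eigenMultiplicity_eq_one_of_even (h.abs_potential_le 1 0) h.solvesODE h.deriv_zero
    (h.pos 0).ne' h.mem_periodicEigenspace fun f hf => h.odd_part_eq_zero₂ le_rfl hf
  have hset : {ν | ν < 0 ∧ IsPeriodicEigenvalue (fun x => σ - 1 * y x ^ 2) (2 * H) ν} = ∅ := by
    refine Set.eq_empty_of_forall_notMem fun ν hν => ?_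
    exact not_isPeriodicEigenvalue (fun f hf => h.even_part_eq_zero₂ hν.1 hf)
      (fun f hf => h.odd_part_eq_zero₂ hν.1.le hf) hν.2
  refine ⟨⟨isPeriodicEigenvalue_of_mem h.mem_periodicEigenspace ⟨0, (h.pos 0).ne'⟩, ?_⟩, hm⟩
  rw [hset, hm]
  simp

/-- The three lowest eigenvalues of `-∂² + σ - 3 y²` are simple, and the second one is `0`. -/
theorem spectrum₁ (h : IsDnoidalProfile η₁ η₂ σ H y y') :
    (∃ l₀ l₂ : ℝ,
      (IsNthEigenvalue (fun x => σ - 3 * y x ^ 2) (2 * H) 0 l₀ ∧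
        eigenMultiplicity (fun x => σ - 3 * y x ^ 2) (2 * H) l₀ = 1) ∧
      (IsNthEigenvalue (fun x => σ - 3 * y x ^ 2) (2 * H) 1 0 ∧
        eigenMultiplicity (fun x => σ - 3 * y x ^ 2) (2 * H) 0 = 1) ∧
      (IsNthEigenvalue (fun x => σ - 3 * y x ^ 2) (2 * H) 2 l₂ ∧
        eigenMultiplicity (fun x => σ - 3 * y x ^ 2) (2 * H) l₂ = 1)) ∧
    ∃! μ : ℝ, μ < 0 ∧ IsPeriodicEigenvalue (fun x => σ - 3 * y x ^ 2) (2 * H) μ := by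
  obtain ⟨r₀, r₂, hr₀, hr₂, h0, h2, h1, h0σ, h2σ⟩ := h.exists_roots
  have hl₀ : 3 * (r₀ - σ) < 0 := by linarith
  have hl₂ : 0 < 3 * (r₂ - σ) := by linarith
  -- Away from `λ₀` the even part vanishes, away from `0` the odd part does, so below `λ₂` no other
  -- eigenvalue is left.
  have hbelow : ∀ ν, ν < 3 * (r₂ - σ) → ν ≠ 3 * (r₀ - σ) → ν ≠ 0 →
      ¬ IsPeriodicEigenvalue (fun x => σ - 3 * y x ^ 2) (2 * H) ν := fun ν a b c =>
    not_isPeriodicEigenvalue (fun f hf => h.even_part_eq_zero₁ hr₀ hr₂ h0 h2 h1 b a hf)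
      (fun f hf => h.odd_part_eq_zero₁ hr₂ h2 h1 c a.le hf)
  have hy0 : (fun x => y x ^ 2 - r₀) 0 ≠ 0 := by
    have := (h.sq_le 0).1
    exact (show 0 < y 0 ^ 2 - r₀ by linarith).ne'
  have hy2 : (fun x => y x ^ 2 - r₂) 0 ≠ 0 := by
    simp only [h.apply_zero]
    exact (sub_pos.2 h1).ne'
  have hy1 : ∃ x, y' x ≠ 0 :=
    ⟨H / 2, (h.deriv_neg _ (half_pos h.half_period_pos) (half_lt_self h.half_period_pos)).ne⟩
  have hab : η₂ ^ 2 < η₁ ^ 2 := h2.trans h1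
  have hη : 0 < η₁ := h.eta₂_pos.trans h.eta₂_lt
  have m0 := eigenMultiplicity_eq_one_of_even (h.abs_potential_le 3 _) (h.solvesODE_sq_sub hr₀)
    (by simp [h.deriv_zero]) hy0 (h.sq_sub_mem_periodicEigenspace hr₀)
    fun f hf => h.odd_part_eq_zero₁ hr₂ h2 h1 hl₀.ne (hl₀.trans hl₂).le hf
  have m2 := eigenMultiplicity_eq_one_of_even (h.abs_potential_le 3 _) (h.solvesODE_sq_sub hr₂)
    (by simp [h.deriv_zero]) hy2 (h.sq_sub_mem_periodicEigenspace hr₂)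
    fun f hf => h.odd_part_eq_zero₁ hr₂ h2 h1 hl₂.ne' le_rfl hf
  have m1 := eigenMultiplicity_eq_one_of_odd (h.abs_potential_le 3 _) h.solvesODE_deriv
    h.deriv_zero (by
      have hs := h.sum_sq
      -- This is `y''(0)`, the initial slope of the odd eigenfunction `y'`; it is nonzero because
      -- `η₂² < η₁²`.
      have : σ * y 0 - y 0 ^ 3 = η₁ * (η₂ ^ 2 - η₁ ^ 2) / 2 := by
        rw [h.apply_zero]
        linear_combination (-η₁ / 2) * hs
      rw [this]
      exact (div_neg_of_neg_of_pos (mul_neg_of_pos_of_neg hη (sub_neg.2 hab)) two_pos).ne)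
    h.deriv_mem_periodicEigenspace hy1
    fun f hf => h.even_part_eq_zero₁ hr₀ hr₂ h0 h2 h1 hl₀.ne' hl₂ hf
  have e0 := isPeriodicEigenvalue_of_mem (h.sq_sub_mem_periodicEigenspace hr₀) ⟨0, hy0⟩
  have e1 := isPeriodicEigenvalue_of_mem h.deriv_mem_periodicEigenspace hy1
  have e2 := isPeriodicEigenvalue_of_mem (h.sq_sub_mem_periodicEigenspace hr₂) ⟨0, hy2⟩
  generalize 3 * (r₀ - σ) = l₀ at *
  generalize 3 * (r₂ - σ) = l₂ at *
  generalize (fun x => σ - 3 * y x ^ 2) = Q at *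
  have s0 : {ν | ν < l₀ ∧ IsPeriodicEigenvalue Q (2 * H) ν} = ∅ :=
    Set.eq_empty_of_forall_notMem fun ν hν =>
      hbelow ν (hν.1.trans (hl₀.trans hl₂)) hν.1.ne (hν.1.trans hl₀).ne hν.2
  have s1 : {ν | ν < 0 ∧ IsPeriodicEigenvalue Q (2 * H) ν} = {l₀} := by
    ext ν
    refine ⟨fun hν => ?_, ?_⟩
    · by_contra hne
      exact hbelow ν (hν.1.trans hl₂) hne hν.1.ne hν.2
    · rintro rfl
      exact ⟨hl₀, e0⟩
  have s2 : {ν | ν < l₂ ∧ IsPeriodicEigenvalue Q (2 * H) ν} = {l₀, 0} := by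
    ext ν
    refine ⟨fun hν => ?_, ?_⟩
    · by_contra hne
      simp only [Set.mem_insert_iff, Set.mem_singleton_iff, not_or] at hne
      exact hbelow ν hν.1 hne.1 hne.2 hν.2
    · rintro (rfl | rfl)
      · exact ⟨hl₀.trans hl₂, e0⟩
      · exact ⟨hl₂, e1⟩
  refine ⟨⟨l₀, l₂, ⟨⟨e0, ?_⟩, m0⟩, ⟨⟨e1, ?_⟩, m1⟩, ⟨e2, ?_⟩, m2⟩, l₀, ⟨hl₀, e0⟩,
    fun ν hν => ?_⟩
  · rw [s0, m0]
    simp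
  · rw [s1, finsum_mem_singleton, m0, m1]
    simp
  · rw [s2, finsum_mem_pair hl₀.ne, m0, m1, m2]
    simp
  · have : ν ∈ ({l₀} : Set ℝ) := s1 ▸ hν
    exact this

end IsDnoidalProfile

/-- The rescaled function `dn` is a dnoidal profile. -/
theorem isDnoidalProfile_jacobiDn {η₁ η₂ σ κ L : ℝ} (hL : 0 < L) (hη₂ : 0 < η₂) (hη : η₂ < η₁)
    (hsum : η₁ ^ 2 + η₂ ^ 2 = 2 * σ) (hκ_pos : 0 < κ)
    (hκ : κ ^ 2 = (η₁ ^ 2 - η₂ ^ 2) / η₁ ^ 2)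
    (hperiod : 2 * Real.sqrt 2 / η₁ * ellipticK κ = L) :
    IsDnoidalProfile η₁ η₂ σ (L / 2) (fun x => η₁ * jacobiDn κ (η₁ / Real.sqrt 2 * x))
      (fun x => η₁ * (η₁ / Real.sqrt 2) * jacobiDnDeriv κ (η₁ / Real.sqrt 2 * x)) := by
  have hη₁ : 0 < η₁ := hη₂.trans hη
  have hs : 0 < Real.sqrt 2 := Real.sqrt_pos.2 two_pos
  have hs2 : Real.sqrt 2 ^ 2 = 2 := Real.sq_sqrt two_pos.le
  have hκ' : κ ^ 2 * η₁ ^ 2 = η₁ ^ 2 - η₂ ^ 2 := by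
    rw [hκ]; field_simp
  have h1 : κ < 1 := by
    by_contra! h
    have h2 := mul_le_mul_of_nonneg_right (one_le_pow₀ h (n := 2)) (sq_nonneg η₁)
    linarith [pow_pos hη₂ 2]
  have h0 := hκ_pos.le
  -- The half period in `x` corresponds to `K(κ)`, where the amplitude is `π / 2` and `dn` has its
  -- minimum.
  have hHK : η₁ / Real.sqrt 2 * (L / 2) = ellipticK κ := by
    rw [← hperiod]; field_simp
  have ha : 0 < η₁ / Real.sqrt 2 := div_pos hη₁ hs
  have ha2 : 2 * (η₁ / Real.sqrt 2) ^ 2 = η₁ ^ 2 := by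
    rw [div_pow, hs2]; ring
  generalize η₁ / Real.sqrt 2 = a at *
  have hd : ∀ x, HasDerivAt (fun x : ℝ => a * x) a x := fun x => by
    simpa using (hasDerivAt_id x).const_mul a
  refine ⟨by linarith, hη₂, hη, hsum, fun x => ?_, fun x => ?_, fun x => ?_, fun x => ?_,
    fun x => ?_, fun x => ?_, ?_, ?_, ?_, fun x hx hxH => ?_⟩
  · exact (((hasDerivAt_jacobiDn h0 h1 (a * x)).comp x (hd x)).const_mul η₁).congr_deriv
      (by ring)
  · refine (((hasDerivAt_jacobiDnDeriv h0 h1 (a * x)).comp x (hd x)).const_mul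
      (η₁ * a)).congr_deriv ?_
    linear_combination (η₁ / 2) * jacobiDn κ (a * x) *
      ((2 - κ ^ 2 - 2 * jacobiDn κ (a * x) ^ 2) * ha2 - hκ' + hsum)
  · have e := jacobiDnDeriv_sq h0 h1 (a * x)
    have hη₂' : η₂ ^ 2 = η₁ ^ 2 * (1 - κ ^ 2) := by linarith
    rw [hη₂', mul_pow, mul_pow, e]
    linear_combination η₁ ^ 2 * ((1 - jacobiDn κ (a * x) ^ 2) *
      (jacobiDn κ (a * x) ^ 2 - (1 - κ ^ 2))) * ha2
  · exact mul_pos hη₁ (jacobiDn_pos h0 h1 _)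
  · simp only [mul_neg, jacobiDn_neg h0 h1]
  · have e : a * (x + 2 * (L / 2)) = a * x + 2 * ellipticK κ := by rw [← hHK]; ring
    simp only [e, jacobiDn_add_two_mul_ellipticK h0 h1]
  · simp [jacobiDn_zero h0 h1]
  · simp [jacobiDnDeriv_zero h0 h1]
  · simp [hHK, jacobiDnDeriv_ellipticK h0 h1]
  · have := jacobiDnDeriv_neg_of_mem hκ_pos h1 (mul_pos ha hx)
      (hHK ▸ mul_lt_mul_of_pos_left hxH ha)
    exact mul_neg_of_pos_of_neg (mul_pos hη₁ ha) this

end Dnoidal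

theorem mainTheorem7 (L β c ω σ η₁ η₂ κ : ℝ) (φ Q₁ Q₂ : ℝ → ℝ)
    (hL : 0 < L) (hc : 0 < c) (hβ : 0 < 1 - β * c)
    (hσ_def : σ = -ω - c ^ 2 / 4) (hσ : 2 * Real.pi ^ 2 / L ^ 2 < σ)
    (hη₂ : 0 < η₂) (hη : η₂ < η₁) (hsum : η₁ ^ 2 + η₂ ^ 2 = 2 * σ)
    (hκ_pos : 0 < κ) (hκ : κ ^ 2 = (η₁ ^ 2 - η₂ ^ 2) / η₁ ^ 2)
    (hperiod : 2 * Real.sqrt 2 / η₁ * Dnoidal.ellipticK κ = L)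
    (hφ : φ = Dnoidal.dnoidalWave β c η₁ κ)
    (hQ₁ : Q₁ = Dnoidal.potential₁ β c ω φ)
    (hQ₂ : Q₂ = Dnoidal.potential₂ β c ω φ) :
    (∃ l₀ l₂ : ℝ,
      (Dnoidal.IsNthEigenvalue Q₁ L 0 l₀ ∧ Dnoidal.eigenMultiplicity Q₁ L l₀ = 1) ∧
      (Dnoidal.IsNthEigenvalue Q₁ L 1 0 ∧ Dnoidal.eigenMultiplicity Q₁ L 0 = 1) ∧
      (Dnoidal.IsNthEigenvalue Q₁ L 2 l₂ ∧ Dnoidal.eigenMultiplicity Q₁ L l₂ = 1)) ∧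
    (deriv φ ∈ Dnoidal.periodicEigenspace Q₁ L 0 ∧ deriv φ ≠ 0) ∧
    (∃! μ : ℝ, μ < 0 ∧ Dnoidal.IsPeriodicEigenvalue Q₁ L μ) ∧
    (Dnoidal.IsNthEigenvalue Q₂ L 0 0 ∧ Dnoidal.eigenMultiplicity Q₂ L 0 = 1) := by
  have h := Dnoidal.isDnoidalProfile_jacobiDn hL hη₂ hη hsum hκ_pos hκ hperiod
  set y := fun x => η₁ * Dnoidal.jacobiDn κ (η₁ / Real.sqrt 2 * x)
  set y' := fun x => η₁ * (η₁ / Real.sqrt 2) * Dnoidal.jacobiDnDeriv κ (η₁ / Real.sqrt 2 * x)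
  have hA : 0 < c / (1 - β * c) := div_pos hc hβ
  have hφy : φ = fun x => Real.sqrt (c / (1 - β * c)) * y x := by
    rw [hφ]
    funext x
    exact mul_assoc _ _ _
  have hφ2 : ∀ x, (β - 1 / c) * φ x ^ 2 = -y x ^ 2 := fun x => by
    -- The amplitude of the wave is chosen for this cancellation, which removes `β` and `c` from the
    -- potentials except through `σ`.
    have e : (β - 1 / c) * (c / (1 - β * c)) = -1 := by
      have := hβ.ne'
      field_simp
      ring
    rw [hφy, mul_pow, Real.sq_sqrt hA.le, ← mul_assoc, e]
    ring
  have hQ₁y : Q₁ = fun x => σ - 3 * y x ^ 2 := by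
    rw [hQ₁]
    funext x
    simp only [Dnoidal.potential₁]
    linear_combination 3 * hφ2 x - hσ_def
  have hQ₂y : Q₂ = fun x => σ - 1 * y x ^ 2 := by
    rw [hQ₂]
    funext x
    simp only [Dnoidal.potential₂]
    linear_combination hφ2 x - hσ_def
  have hdφ : deriv φ = Real.sqrt (c / (1 - β * c)) • y' := by
    rw [hφy]
    funext x
    exact ((h.hasDerivAt x).const_mul _).deriv
  have hLH : 2 * (L / 2) = L := by ring
  have hspec₁ := h.spectrum₁
  have hspec₂ := h.spectrum₂
  have hmem := h.deriv_mem_periodicEigenspace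
  rw [hLH, ← hQ₁y] at hspec₁ hmem
  rw [hLH, ← hQ₂y] at hspec₂
  refine ⟨hspec₁.1, ⟨?_, ?_⟩, hspec₁.2, hspec₂⟩
  · rw [hdφ]
    exact Submodule.smul_mem _ _ hmem
  · rw [hdφ]
    intro h0
    -- Any point of `(0, L / 2)` would do, since `y'` is negative there.
    have h1 := congrFun h0 (L / 2 / 2)
    have h2 := h.deriv_neg (L / 2 / 2) (by linarith) (by linarith)
    exact (mul_neg_of_pos_of_neg (Real.sqrt_pos.2 hA) h2).ne h1
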